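/- Let $f\in\mathbb{Q}[x]$. (i) Let $\arcsin,\arccos:[-1,1]\to\mathbb{R}$, $\arctan,\operatorname{arccot}:\mathbb{R}\to\mathbb{R}$ and $\operatorname{arcsec},\operatorname{arccsc}:\{x\in\mathbb{R}:|x|\ge 1\}\to\mathbb{R}$ be the real principal inverse trigonometric functions, where $\operatorname{arccot}x=\frac{\pi}{2}-\arctan x$, $\operatorname{arcsec}x=\arccos(1/x)$ and $\operatorname{arccsc}x=\arcsin(1/x)$. If a real number $\alpha\neq 0$ with $f(\alpha)\neq 0$ lies in the domain of one of these six functions $g$ and satisfies $g(\alpha)=f(\alpha)$, then $\alpha$ is transcendental (over $\mathbb{Q}$). (ii) The same holds for complex solutions and for every branch of the inverse functions: if $\alpha\in\mathbb{C}$, $\alpha\ne 0$, $f(\alpha)\neq 0$, and $f(\alpha)$ is one of the values at $\alpha$ of the multivalued complex function $\arcsin$, $\arccos$, $\arctan$, $\operatorname{arccot}$, $\operatorname{arcsec}$ or $\operatorname{arccsc}$ (that is, $f(\alpha)$ is a complex number at which the corresponding function $\sin$, $\cos$, $\tan$, $\cot$, $\sec$ or $\csc$ is defined and takes the value $\alpha$),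 then $\alpha$ is transcendental. -/

import Mathlib

namespace InverseTrig

/-- The real arccotangent, defined on all of `ℝ`, with range `(0, π)`. -/
noncomputable def arccot (x : ℝ) : ℝ := Real.pi / 2 - Real.arctan x

/-- The real arcsecant, with range `[0, π] \ {π / 2}`; meaningful for `1 ≤ |x|`. -/
noncomputable def arcsec (x : ℝ) : ℝ := Real.arccos (1 / x)

/-- The real arccosecant, with range `[-π / 2, π / 2] \ {0}`; meaningful for `1 ≤ |x|`. -/
noncomputable def arccsc (x : ℝ) : ℝ := Real.arcsin (1 / x)

/-- All values of the multivalued complex function arcsin at `z`. -/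
def cArcsin (z : ℂ) : Set ℂ := {w | Complex.sin w = z}

/-- All values of the multivalued complex function arccos at `z`. -/
def cArccos (z : ℂ) : Set ℂ := {w | Complex.cos w = z}

/-- All values of the multivalued complex function arctan at `z` (poles of tan excluded). -/
def cArctan (z : ℂ) : Set ℂ := {w | Complex.cos w ≠ 0 ∧ Complex.tan w = z}

/-- All values of the multivalued complex function arccot at `z` (poles of cot excluded). -/
def cArccot (z : ℂ) : Set ℂ := {w | Complex.sin w ≠ 0 ∧ Complex.cot w = z}

/-- All values of the multivalued complex function arcsec at `z` (poles of sec excluded). -/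
def cArcsec (z : ℂ) : Set ℂ := {w | Complex.cos w ≠ 0 ∧ 1 / Complex.cos w = z}

/-- All values of the multivalued complex function arccsc at `z` (poles of csc excluded). -/
def cArccsc (z : ℂ) : Set ℂ := {w | Complex.sin w ≠ 0 ∧ 1 / Complex.sin w = z}

end InverseTrig

/-! If `α` is algebraic, so is the nonzero number `w = f(α)`, and some trigonometric function of `w`
equals `α`. By Hermite–Lindemann `exp (w * I)` is transcendental, hence so are `cos w`, `sin w` and
`tan w`, and their reciprocals: a contradiction. For Hermite–Lindemann, `h(exp β) = 0` with `h`
integral makes `expEval` kill a nonzero element of the group ring `ℤ[L]`, with `L` Galois over `ℚ`.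
Its Galois norm is a nonzero invariant element, and an invariant multiple of that has nonzero
constant term. Hermite's approximation (`intCast_add_sum_mul_exp_ne_zero`) shows that `expEval`
cannot kill such an element. -/

/-! ### Hermite's approximation argument -/

open Polynomial in
theorem isIntegral_pow_mul_aeval {A : Type*} [CommRing A] {a : ℤ} {x : A}
    (h : IsIntegral ℤ ((a : A) * x)) {g : ℤ[X]} {N : ℕ} (hN : g.natDegree ≤ N) :
    IsIntegral ℤ ((a : A) ^ N * aeval x g) := by
  rw [aeval_eq_sum_range' (Nat.lt_succ_of_le hN), Finset.mul_sum]
  refine IsIntegral.sum _ fun i hi => ?_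
  have hi' : i ≤ N := Nat.lt_succ_iff.mp (Finset.mem_range.mp hi)
  have : (a : A) ^ N * g.coeff i • x ^ i
      = algebraMap ℤ A (g.coeff i * a ^ (N - i)) * ((a : A) * x) ^ i := by
    rw [zsmul_eq_mul, mul_pow]
    nth_rw 1 [← Nat.sub_add_cancel hi', pow_add]
    simp only [eq_intCast, Int.cast_mul, Int.cast_pow]
    ring
  rw [this]
  exact isIntegral_algebraMap.mul (h.pow i)

theorem exists_intCast_eq_of_isIntegral_of_fixed {L : Type*} [Field L] [Algebra ℚ L]
    [FiniteDimensional ℚ L] [IsGalois ℚ L] {x : L} (hx : IsIntegral ℤ x)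
    (hfix : ∀ σ : Gal(L/ℚ), σ x = x) : ∃ t : ℤ, (t : L) = x := by
  obtain ⟨q, rfl⟩ := (IsGalois.mem_range_algebraMap_iff_fixed x).mpr hfix
  rw [isIntegral_algebraMap_iff (algebraMap ℚ L).injective] at hx
  obtain ⟨t, rfl⟩ := IsIntegrallyClosed.isIntegral_iff.mp hx
  exact ⟨t, by simp⟩

open Polynomial in
/-- An integer polynomial not vanishing at `0` and vanishing at prescribed nonzero algebraic
numbers. -/
theorem exists_polynomial_aeval_eq_zero_of_finset {L : Type*} [Field L] [Algebra ℚ L]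
    [FiniteDimensional ℚ L] (S : Finset L) (h0 : (0 : L) ∉ S) :
    ∃ f : ℤ[X], f.eval 0 ≠ 0 ∧ ∀ γ ∈ S, aeval γ f = 0 := by
  have key : ∀ γ : L, ∃ q : ℤ[X], q.eval 0 ≠ 0 ∧ (γ ≠ 0 → aeval γ q = 0) := by
    intro γ
    by_cases hγ : γ = 0
    · exact ⟨1, by simp, fun h => absurd hγ h⟩
    have halg : IsAlgebraic ℤ γ :=
      (IsFractionRing.isAlgebraic_iff ℤ ℚ L).mpr (Algebra.IsAlgebraic.isAlgebraic γ)
    obtain ⟨q, hq0, hq⟩ :=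
      halg.exists_nonzero_coeff_and_aeval_eq_zero (mem_nonZeroDivisors_of_ne_zero hγ)
    exact ⟨q, by rwa [← coeff_zero_eq_eval_zero], fun _ => hq⟩
  choose q hq0 hq using key
  refine ⟨∏ γ ∈ S, q γ, ?_, fun γ hγ => ?_⟩
  · rw [eval_prod]
    exact Finset.prod_ne_zero_iff.mpr fun γ _ => hq0 γ
  · rw [map_prod]
    exact Finset.prod_eq_zero hγ (hq γ (ne_of_mem_of_not_mem hγ h0))

theorem exists_forall_mul_pow_div_factorial_lt_one (C M : ℝ) :
    ∃ N : ℕ, ∀ p ≥ N, C * (M ^ p / ((p - 1).factorial : ℝ)) < 1 := by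
  have h := (FloorSemiring.tendsto_pow_div_factorial_atTop M).const_mul (C * M)
  rw [mul_zero] at h
  obtain ⟨N, hN⟩ := Filter.eventually_atTop.mp (h.eventually (gt_mem_nhds one_pos))
  refine ⟨N + 1, fun p hp => ?_⟩
  obtain ⟨k, rfl⟩ : ∃ k, p = k + 1 := ⟨p - 1, by omega⟩
  have := hN k (by omega)
  calc _ = C * M * (M ^ k / (k.factorial : ℝ)) := by
        rw [Nat.add_sub_cancel, pow_succ]; ring
    _ < 1 := this

open Polynomial in
/-- A Galois-invariant integral linear combination of exponentials of nonzero algebraic numbers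
is never a nonzero integer. -/
theorem intCast_add_sum_mul_exp_ne_zero {L : Type*} [Field L] [Algebra ℚ L]
    [FiniteDimensional ℚ L] [IsGalois ℚ L] [Algebra L ℂ] (S : Finset L) (h0 : (0 : L) ∉ S)
    (hS : ∀ (σ : Gal(L/ℚ)), ∀ γ ∈ S, σ γ ∈ S) (b : L → ℤ)
    (hb : ∀ (σ : Gal(L/ℚ)) (γ : L), b (σ γ) = b γ) {b₀ : ℤ} (hb₀ : b₀ ≠ 0) :
    (b₀ : ℂ) + ∑ γ ∈ S, (b γ : ℂ) * Complex.exp (algebraMap L ℂ γ) ≠ 0 := by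
  intro hsum
  obtain ⟨f, hf0, hfS⟩ := exists_polynomial_aeval_eq_zero_of_finset S h0
  have hf : f ≠ 0 := by rintro rfl; simp at hf0
  obtain ⟨c, hc⟩ := LindemannWeierstrass.exp_polynomial_approx f hf0
  obtain ⟨a, ha0, ha⟩ := exists_integral_multiples ℤ ℚ S
  simp_rw [zsmul_eq_mul] at ha
  set d := f.natDegree
  set C : ℝ := ∑ γ ∈ S, |(b γ : ℝ)|
  obtain ⟨N, hN⟩ := exists_forall_mul_pow_div_factorial_lt_one C (|(a : ℝ)| ^ d * c)
  -- `p` exceeds `|f(0)|` for the approximation to apply, `|a|` and `|b₀|` so as to divide neither,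
  -- and `N` for the final estimate.
  obtain ⟨p, hp, hpp⟩ := Nat.exists_infinite_primes
    (N + (eval 0 f).natAbs + a.natAbs + b₀.natAbs + 1)
  obtain ⟨n, hn, g, hgdeg, hg⟩ := hc p (by omega) hpp
  have hpp' : Prime (p : ℤ) := Nat.prime_iff_prime_int.mp hpp
  -- The power of `a` clears denominators, and Galois invariance makes the sum rational.
  obtain ⟨t, ht⟩ : ∃ t : ℤ, (t : L) = ∑ γ ∈ S, (b γ : L) * ((a : L) ^ (p * d) * aeval γ g) := by
    refine exists_intCast_eq_of_isIntegral_of_fixed (IsIntegral.sum _ fun γ hγ => ?_) fun σ => ?_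
    · have : IsIntegral ℤ ((b γ : L)) := by
        simpa using isIntegral_algebraMap (R := ℤ) (A := L) (x := b γ)
      exact this.mul (isIntegral_pow_mul_aeval (ha γ hγ) (hgdeg.trans (Nat.sub_le _ _)))
    · rw [map_sum]
      refine Finset.sum_bij (fun γ _ => σ γ) (hS σ) (fun _ _ _ _ h => σ.injective h)
        (fun γ hγ => ⟨σ.symm γ, hS σ.symm γ hγ, by simp⟩) fun γ _ => ?_
      have : σ (aeval γ g) = aeval (σ γ) g :=
        (aeval_algHom_apply ((σ : L →ₐ[ℚ] L).restrictScalars ℤ) γ g).symm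
      simp [hb, this]
  -- The relation times `a ^ (p * d) * n`, with each `n * exp γ` replaced by `p * g(γ)`. It is
  -- nonzero modulo `p`, yet the approximation errors bound it below 1.
  set m : ℤ := a ^ (p * d) * n * b₀ + p * t
  have hm : m ≠ 0 := by
    intro hm
    have hdvd : (p : ℤ) ∣ a ^ (p * d) * n * b₀ := by
      rw [← dvd_add_left (dvd_mul_right (p : ℤ) t)]
      change (p : ℤ) ∣ m
      exact hm.symm ▸ dvd_zero _
    have small : ∀ z : ℤ, z ≠ 0 → z.natAbs < p → ¬ (p : ℤ) ∣ z := fun z hz hlt h =>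
      absurd (Nat.le_of_dvd (Int.natAbs_pos.mpr hz) (Int.natCast_dvd.mp h)) (by omega)
    rcases hpp'.dvd_or_dvd hdvd with h | h
    · rcases hpp'.dvd_or_dvd h with h | h
      · exact small a ha0 (by omega) (hpp'.dvd_of_dvd_pow h)
      · exact hn h
    · exact small b₀ hb₀ (by omega) h
  have hmC : (m : ℂ) = -(a : ℂ) ^ (p * d) * ∑ γ ∈ S, (b γ : ℂ) *
      (n • Complex.exp (algebraMap L ℂ γ) - p • aeval (algebraMap L ℂ γ) g) := by
    have htC := congrArg (algebraMap L ℂ) ht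
    simp only [map_intCast, map_sum, map_mul, map_pow] at htC
    have h1 : ∀ γ, aeval (algebraMap L ℂ γ) g = algebraMap L ℂ (aeval γ g) := fun γ =>
      aeval_algebraMap_apply ℂ γ g
    have h2 : (b₀ : ℂ) = -∑ γ ∈ S, (b γ : ℂ) * Complex.exp (algebraMap L ℂ γ) :=
      eq_neg_of_add_eq_zero_left hsum
    simp only [m, Int.cast_add, Int.cast_mul, Int.cast_pow, Int.cast_natCast, htC, h2, h1,
      zsmul_eq_mul, nsmul_eq_mul, mul_neg, Finset.mul_sum, ← Finset.sum_neg_distrib,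
      ← Finset.sum_add_distrib]
    exact Finset.sum_congr rfl fun γ _ => by ring
  have hle : ‖(m : ℂ)‖ ≤ C * ((|(a : ℝ)| ^ d * c) ^ p / ((p - 1).factorial : ℝ)) := by
    rw [hmC, norm_mul, norm_neg, norm_pow, Complex.norm_intCast]
    calc _ ≤ |(a : ℝ)| ^ (p * d) * ∑ γ ∈ S, |(b γ : ℝ)| * (c ^ p / ((p - 1).factorial : ℝ)) := by
          gcongr
          refine (norm_sum_le _ _).trans (Finset.sum_le_sum fun γ hγ => ?_)
          rw [norm_mul, Complex.norm_intCast]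
          gcongr
          refine hg ?_
          rw [mem_aroots]
          exact ⟨hf, by rw [aeval_algebraMap_apply, hfS γ hγ, map_zero]⟩
      _ = _ := by rw [← Finset.sum_mul, mul_pow, ← pow_mul, mul_comm p d]; ring
  have hge : (1 : ℝ) ≤ ‖(m : ℂ)‖ := by
    rw [Complex.norm_intCast]; exact_mod_cast Int.one_le_abs hm
  exact absurd (hge.trans hle) (not_le.mpr (hN p (by omega)))

/-! ### Group ring, Galois action and Hermite–Lindemann -/

/-- The ring homomorphism from the group ring of `L` to `ℂ` sending `γ` to `exp γ`. -/
noncomputable def expEval (L : Type*) [Field L] [Algebra L ℂ] : AddMonoidAlgebra ℤ L →ₐ[ℤ] ℂ :=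
  AddMonoidAlgebra.lift ℤ ℂ L
    (Complex.expMonoidHom.comp (algebraMap L ℂ).toAddMonoidHom.toMultiplicative)

theorem expEval_single {L : Type*} [Field L] [Algebra L ℂ] (γ : L) (c : ℤ) :
    expEval L (AddMonoidAlgebra.single γ c) = c * Complex.exp (algebraMap L ℂ γ) := by
  simp [expEval, AddMonoidAlgebra.lift_single]

theorem expEval_apply {L : Type*} [Field L] [Algebra L ℂ] (x : AddMonoidAlgebra ℤ L) :
    expEval L x = ∑ γ ∈ x.coeff.support, (x.coeff γ : ℂ) * Complex.exp (algebraMap L ℂ γ) := by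
  simp [expEval, AddMonoidAlgebra.lift_apply, Finsupp.sum]

/-- The action of the Galois group on the group ring of `L`. -/
noncomputable def galConj {L : Type*} [Field L] [Algebra ℚ L] (σ : Gal(L/ℚ)) :
    AddMonoidAlgebra ℤ L ≃ₐ[ℤ] AddMonoidAlgebra ℤ L :=
  AddMonoidAlgebra.domCongr ℤ ℤ (σ : L ≃+ L)

theorem galConj_single {L : Type*} [Field L] [Algebra ℚ L] (σ : Gal(L/ℚ)) (γ : L) (c : ℤ) :
    galConj σ (AddMonoidAlgebra.single γ c) = AddMonoidAlgebra.single (σ γ) c :=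
  AddMonoidAlgebra.domCongr_single ..

theorem coeff_galConj {L : Type*} [Field L] [Algebra ℚ L] (σ : Gal(L/ℚ))
    (x : AddMonoidAlgebra ℤ L) (γ : L) : (galConj σ x).coeff γ = x.coeff (σ.symm γ) :=
  AddMonoidAlgebra.coeff_domCongr ..

theorem galConj_mul_apply {L : Type*} [Field L] [Algebra ℚ L] (σ τ : Gal(L/ℚ))
    (x : AddMonoidAlgebra ℤ L) : galConj (σ * τ) x = galConj σ (galConj τ x) := by
  ext γ
  simp only [coeff_galConj]
  rfl

theorem coeff_apply_of_galConj_eq {L : Type*} [Field L] [Algebra ℚ L] {x : AddMonoidAlgebra ℤ L}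
    (hx : ∀ σ : Gal(L/ℚ), galConj σ x = x) (σ : Gal(L/ℚ)) (γ : L) :
    x.coeff (σ γ) = x.coeff γ := by
  conv_lhs => rw [← hx σ]
  simp [coeff_galConj]

theorem expEval_ne_zero_of_coeff_zero_ne_zero {L : Type*} [Field L] [Algebra ℚ L]
    [FiniteDimensional ℚ L] [IsGalois ℚ L] [Algebra L ℂ] {x : AddMonoidAlgebra ℤ L}
    (hx : ∀ σ : Gal(L/ℚ), galConj σ x = x) (h0 : x.coeff 0 ≠ 0) : expEval L x ≠ 0 := by
  classical
  have hcoeff := coeff_apply_of_galConj_eq hx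
  have := intCast_add_sum_mul_exp_ne_zero (x.coeff.support.erase 0)
    (Finset.notMem_erase 0 _) (fun σ γ hγ => by
      simp only [Finset.mem_erase, Finsupp.mem_support_iff, hcoeff] at hγ ⊢
      exact ⟨by simpa using hγ.1, hγ.2⟩) (fun γ => x.coeff γ) hcoeff h0
  rw [expEval_apply, ← Finset.add_sum_erase _ _ (Finsupp.mem_support_iff.mpr h0)]
  simpa using this

/-- Multiplying by the invariant sum of the `single (-σ γ) 1` moves the equal coefficients at all `σ
γ` to `0`, giving constant term `|Gal| * x.coeff γ`. -/
theorem expEval_ne_zero_of_invariant {L : Type*} [Field L] [Algebra ℚ L]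
    [FiniteDimensional ℚ L] [IsGalois ℚ L] [Algebra L ℂ] {x : AddMonoidAlgebra ℤ L}
    (hx : ∀ σ : Gal(L/ℚ), galConj σ x = x) (hx0 : x ≠ 0) : expEval L x ≠ 0 := by
  obtain ⟨γ, hγ⟩ : ∃ γ, x.coeff γ ≠ 0 := by
    by_contra! h
    exact hx0 (AddMonoidAlgebra.ext (Finsupp.ext h))
  set y : AddMonoidAlgebra ℤ L := ∑ σ : Gal(L/ℚ), AddMonoidAlgebra.single (-σ γ) 1
  have hy : ∀ τ : Gal(L/ℚ), galConj τ y = y := fun τ => by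
    simp only [y, map_sum, galConj_single, map_neg]
    exact Fintype.sum_equiv (Equiv.mulLeft τ) _ _ fun σ => rfl
  have hxy : expEval L (x * y) ≠ 0 := by
    refine expEval_ne_zero_of_coeff_zero_ne_zero (fun σ => by rw [map_mul, hx, hy]) ?_
    simp only [y, Finset.mul_sum, AddMonoidAlgebra.coeff_sum, Finsupp.finsetSum_apply,
      AddMonoidAlgebra.coeff_mul_single_apply, neg_neg, zero_add, mul_one,
      coeff_apply_of_galConj_eq hx, Finset.sum_const, Finset.card_univ, nsmul_eq_mul]
    exact mul_ne_zero (Nat.cast_ne_zero.mpr Fintype.card_ne_zero) hγ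
  exact fun h => hxy (by rw [map_mul, h, zero_mul])

/-- The product of all conjugates of `x` is invariant, and nonzero because the group ring has no
zero divisors; `x` is its factor at `σ = 1`. -/
theorem expEval_ne_zero {L : Type*} [Field L] [Algebra ℚ L] [FiniteDimensional ℚ L]
    [IsGalois ℚ L] [Algebra L ℂ] {x : AddMonoidAlgebra ℤ L} (hx0 : x ≠ 0) : expEval L x ≠ 0 := by
  have hinv : ∀ τ : Gal(L/ℚ), galConj τ (∏ σ : Gal(L/ℚ), galConj σ x)
      = ∏ σ : Gal(L/ℚ), galConj σ x := fun τ => by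
    simp only [map_prod, ← galConj_mul_apply]
    exact Fintype.prod_equiv (Equiv.mulLeft τ) _ _ fun σ => rfl
  have hone : galConj (1 : Gal(L/ℚ)) x = x := by
    ext γ
    rw [coeff_galConj]
    rfl
  have := expEval_ne_zero_of_invariant hinv (Finset.prod_ne_zero_iff.mpr fun σ _ =>
    (map_ne_zero_iff _ (galConj σ).injective).mpr hx0)
  rw [map_prod, Finset.prod_ne_zero_iff] at this
  simpa [hone] using this 1 (Finset.mem_univ _)

-- In characteristic zero the exponents `i * β` are distinct, so the leading coefficient of `h`
-- survives.
open Polynomial in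
theorem aeval_single_ne_zero {L : Type*} [Field L] [CharZero L] {β : L} (hβ : β ≠ 0) {h : ℤ[X]}
    (hh : h ≠ 0) : aeval (AddMonoidAlgebra.single β (1 : ℤ)) h ≠ 0 := by
  intro h0
  have h1 := congrArg (fun x => x.coeff ((h.natDegree : L) * β)) h0
  simp only [aeval_eq_sum_range, AddMonoidAlgebra.single_pow, one_pow,
    AddMonoidAlgebra.smul_single, AddMonoidAlgebra.coeff_sum, Finsupp.finsetSum_apply,
    AddMonoidAlgebra.coeff_single, nsmul_eq_mul, AddMonoidAlgebra.coeff_zero, Finsupp.coe_zero,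
    Pi.zero_apply] at h1
  rw [Finset.sum_eq_single h.natDegree] at h1
  · simp [hh] at h1
  · intro i _ hi
    exact Finsupp.single_eq_of_ne (by simpa [hβ] using hi.symm)
  · simp

/-- **Hermite–Lindemann theorem**. -/
theorem transcendental_exp_of_isAlgebraic {β : ℂ} (hβ : IsAlgebraic ℚ β) (hβ0 : β ≠ 0) :
    Transcendental ℚ (Complex.exp β) := by
  intro halg
  let L := IntermediateField.adjoin ℚ ((minpoly ℚ β).rootSet ℂ)
  have : (minpoly ℚ β).IsSplittingField ℚ L :=
    IntermediateField.adjoin_rootSet_isSplittingField (IsAlgClosed.splits _)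
  have : FiniteDimensional ℚ L := Polynomial.IsSplittingField.finiteDimensional L (minpoly ℚ β)
  have : IsGalois ℚ L :=
    IsGalois.of_separable_splitting_field (minpoly.irreducible hβ.isIntegral).separable
  have hmem : β ∈ L := IntermediateField.subset_adjoin _ _
    ((Polynomial.mem_rootSet_of_ne (minpoly.ne_zero hβ.isIntegral)).mpr (minpoly.aeval ℚ β))
  obtain ⟨h, hh, hroot⟩ := (IsFractionRing.isAlgebraic_iff ℤ ℚ ℂ).mpr halg
  have hne : (⟨β, hmem⟩ : L) ≠ 0 := fun h => hβ0 (congrArg Subtype.val h)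
  refine expEval_ne_zero (aeval_single_ne_zero hne hh) ?_
  rw [← Polynomial.aeval_algHom_apply, expEval_single]
  simpa using hroot

/-! ### Trigonometric values at algebraic points -/

/-- As `sin² + cos² = 1`, if either is algebraic then both are, and so is `exp (w * I) = cos w + sin
w * I`. -/
theorem transcendental_cos_and_sin {w : ℂ} (hw : IsAlgebraic ℚ w) (hw0 : w ≠ 0) :
    Transcendental ℚ (Complex.cos w) ∧ Transcendental ℚ (Complex.sin w) := by
  have hI : IsAlgebraic ℚ Complex.I :=
    (IsIntegral.of_pow two_pos (by rw [Complex.I_sq]; exact isIntegral_one.neg)).isAlgebraic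
  have hexp := transcendental_exp_of_isAlgebraic (hw.mul hI) (mul_ne_zero hw0 Complex.I_ne_zero)
  rw [Complex.exp_mul_I] at hexp
  have hsq := Complex.sin_sq_add_cos_sq w
  constructor <;> intro h
  · have hs : IsAlgebraic ℚ (Complex.sin w) := by
      refine IsAlgebraic.of_pow two_pos ?_
      rw [eq_sub_of_add_eq hsq]
      exact isAlgebraic_one.sub (h.pow 2)
    exact hexp (h.add (hs.mul hI))
  · have hc : IsAlgebraic ℚ (Complex.cos w) := by
      refine IsAlgebraic.of_pow two_pos ?_
      rw [eq_sub_of_add_eq' hsq]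
      exact isAlgebraic_one.sub (h.pow 2)
    exact hexp (hc.add (h.mul hI))

theorem transcendental_tan {w : ℂ} (hw : IsAlgebraic ℚ w) (hw0 : w ≠ 0)
    (hcos : Complex.cos w ≠ 0) : Transcendental ℚ (Complex.tan w) := by
  intro h
  refine (transcendental_cos_and_sin hw hw0).1 (IsAlgebraic.of_pow two_pos ?_)
  rw [← Complex.inv_one_add_tan_sq hcos]
  exact (isAlgebraic_one.add (h.pow 2)).inv

theorem IsAlgebraic.polynomial_aeval {α : ℂ} (hα : IsAlgebraic ℚ α) (f : Polynomial ℚ) :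
    IsAlgebraic ℚ (Polynomial.aeval α f) :=
  IsIntegral.isAlgebraic (IsIntegral.of_mem_of_fg _ hα.isIntegral.fg_adjoin_singleton _
    (Polynomial.aeval_mem_adjoin_singleton ℚ α))

theorem transcendental_of_aeval_mem_inverse_trig (f : Polynomial ℚ) (α : ℂ)
    (hf : Polynomial.aeval α f ≠ 0)
    (h : Polynomial.aeval α f ∈ InverseTrig.cArcsin α ∨
      Polynomial.aeval α f ∈ InverseTrig.cArccos α ∨
      Polynomial.aeval α f ∈ InverseTrig.cArctan α ∨
      Polynomial.aeval α f ∈ InverseTrig.cArccot α ∨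
      Polynomial.aeval α f ∈ InverseTrig.cArcsec α ∨
      Polynomial.aeval α f ∈ InverseTrig.cArccsc α) :
    Transcendental ℚ α := by
  intro hα
  have hw := hα.polynomial_aeval f
  generalize Polynomial.aeval α f = w at hf h hw
  obtain ⟨hcos, hsin⟩ := transcendental_cos_and_sin hw hf
  rcases h with h | h | ⟨hc, h⟩ | ⟨hs, h⟩ | ⟨-, h⟩ | ⟨-, h⟩
  · exact hsin (h ▸ hα)
  · exact hcos (h ▸ hα)
  · exact transcendental_tan hw hf hc (h ▸ hα)
  -- A transcendental cosine cannot vanish, so `tan w = 1 / cot w` is covered by the tangent case.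
  · have hc : Complex.cos w ≠ 0 := fun h0 => hcos (h0 ▸ isAlgebraic_zero)
    refine transcendental_tan hw hf hc ?_
    rw [← Complex.cot_inv_eq_tan, h]
    exact hα.inv
  · refine hcos (IsAlgebraic.inv_iff.mp ?_)
    rw [← one_div, h]
    exact hα
  · refine hsin (IsAlgebraic.inv_iff.mp ?_)
    rw [← one_div, h]
    exact hα

theorem Transcendental.of_ofReal {α : ℝ} (h : Transcendental ℚ (α : ℂ)) : Transcendental ℚ α :=
  (transcendental_algebraMap_iff (R := ℚ) (A := ℂ) Complex.ofReal_injective).mp h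

theorem one_div_mem_Icc_of_one_le_abs {x : ℝ} (hx : 1 ≤ |x|) : 1 / x ∈ Set.Icc (-1 : ℝ) 1 := by
  rw [Set.mem_Icc, ← abs_le, abs_div, abs_one]
  exact div_le_one_of_le₀ hx (abs_nonneg x)

theorem corollary3 (f : Polynomial ℚ) :
    (∀ α : ℝ, α ≠ 0 → Polynomial.aeval α f ≠ 0 →
      ((α ∈ Set.Icc (-1 : ℝ) 1 ∧ Real.arcsin α = Polynomial.aeval α f) ∨
        (α ∈ Set.Icc (-1 : ℝ) 1 ∧ Real.arccos α = Polynomial.aeval α f) ∨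
        Real.arctan α = Polynomial.aeval α f ∨
        InverseTrig.arccot α = Polynomial.aeval α f ∨
        (1 ≤ |α| ∧ InverseTrig.arcsec α = Polynomial.aeval α f) ∨
        (1 ≤ |α| ∧ InverseTrig.arccsc α = Polynomial.aeval α f)) →
      Transcendental ℚ α) ∧
    (∀ α : ℂ, α ≠ 0 → Polynomial.aeval α f ≠ 0 →
      (Polynomial.aeval α f ∈ InverseTrig.cArcsin α ∨
        Polynomial.aeval α f ∈ InverseTrig.cArccos α ∨
        Polynomial.aeval α f ∈ InverseTrig.cArctan α ∨
        Polynomial.aeval α f ∈ InverseTrig.cArccot α ∨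
        Polynomial.aeval α f ∈ InverseTrig.cArcsec α ∨
        Polynomial.aeval α f ∈ InverseTrig.cArccsc α) →
      Transcendental ℚ α) := by
  refine ⟨fun α hα hf h => ?_, fun α _ hf h => transcendental_of_aeval_mem_inverse_trig f α hf h⟩
  have hval : Polynomial.aeval (α : ℂ) f = ((Polynomial.aeval α f : ℝ) : ℂ) :=
    Polynomial.aeval_algebraMap_apply ℂ α f
  -- Each real principal value is one of the complex values, so the real part follows from the
  -- complex one.
  refine Transcendental.of_ofReal (transcendental_of_aeval_mem_inverse_trig f α ?_ ?_)
  · rwa [hval, Complex.ofReal_ne_zero]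
  rw [hval]
  rcases h with ⟨hd, h⟩ | ⟨hd, h⟩ | h | h | ⟨hd, h⟩ | ⟨hd, h⟩ <;> rw [← h]
  · left
    simp only [InverseTrig.cArcsin, Set.mem_ofPred_eq]
    exact_mod_cast Real.sin_arcsin hd.1 hd.2
  · right; left
    simp only [InverseTrig.cArccos, Set.mem_ofPred_eq]
    exact_mod_cast Real.cos_arccos hd.1 hd.2
  · right; right; left
    refine ⟨?_, ?_⟩
    · exact_mod_cast (Real.cos_arctan_pos α).ne'
    · exact_mod_cast Real.tan_arctan α
  · right; right; right; left
    have hs : Real.sin (InverseTrig.arccot α) = Real.cos (Real.arctan α) :=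
      Real.sin_pi_div_two_sub _
    have hc : Real.cos (InverseTrig.arccot α) = Real.sin (Real.arctan α) :=
      Real.cos_pi_div_two_sub _
    refine ⟨?_, ?_⟩
    · rw [← Complex.ofReal_sin, hs]
      exact_mod_cast (Real.cos_arctan_pos α).ne'
    · rw [Complex.cot, ← Complex.ofReal_sin, ← Complex.ofReal_cos, hs, hc, ← Complex.ofReal_div,
        ← Real.tan_eq_sin_div_cos, Real.tan_arctan]
  · right; right; right; right; left
    have hc : Real.cos (InverseTrig.arcsec α) = 1 / α :=
      have := one_div_mem_Icc_of_one_le_abs hd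
      Real.cos_arccos this.1 this.2
    refine ⟨?_, ?_⟩ <;> rw [← Complex.ofReal_cos, hc]
    · exact_mod_cast one_div_ne_zero hα
    · simp
  · right; right; right; right; right
    have hs : Real.sin (InverseTrig.arccsc α) = 1 / α :=
      have := one_div_mem_Icc_of_one_le_abs hd
      Real.sin_arcsin this.1 this.2
    refine ⟨?_, ?_⟩ <;> rw [← Complex.ofReal_sin, hs]
    · exact_mod_cast one_div_ne_zero hα
    · simp
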